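/- Let $\mathfrak S_n$ be the set of permutations of $[n]=\{1,\dots,n\}$, let $\ell(\pi)$ be the length of a longest increasing subsequence of $\pi\in\mathfrak S_n$, and put $L_{n,k}=\{\pi\in\mathfrak S_n : \ell(\pi)=k\}$ and $I_{n,k}=\{\pi\in L_{n,k} : \pi^2=\mathrm{id}\}$. The shape $\operatorname{sh}\pi$ of a permutation $\pi$ is the common shape of the two standard Young tableaux that the Robinson–Schensted algorithm (row insertion) assigns to $\pi$, and $\operatorname{sh}(\pi,\pi')=(\operatorname{sh}\pi,\operatorname{sh}\pi')$. A map $F$ between sets of pairs of permutations is called shape preserving if, for all $(\pi,\pi')$ and $(\sigma,\sigma')$ in its domain, $\operatorname{sh}(\pi,\pi')=\operatorname{sh}(\sigma,\sigma')$ implies $\operatorname{sh}F(\pi,\pi')=\operatorname{sh}F(\sigma,\sigma')$. **Theorem.** Let $n\ge 0$ and $k\ge 1$ be integers. If there is a shape-preserving injection $f:I_{n,k-1}\times I_{n,k+1}\to I_{n,k}\times I_{n,k}$, then there is a shape-preserving injection $F:L_{n,k-1}\times L_{n,k+1}\to L_{n,k}\times L_{n,k}$. Consequently, if for a given $n$ such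 an injection $f$ exists for every $1\le k\le n$, then the sequence $\ell_{n,k}=\#L_{n,k}$ $(1\le k\le n)$ is log concave, that is, $\ell_{n,k-1}\,\ell_{n,k+1}\le \ell_{n,k}^2$ for all $1\le k\le n$, with the convention $\ell_{n,0}=\ell_{n,n+1}=0$. -/

import Mathlib

namespace IncSubseq

/-- The length `ℓ(π)` of a longest increasing subsequence of `π`: the largest size of a set of
positions on which the one-line notation of `π` is increasing. Permutations of `[n]` are modelled
as permutations of `Fin n`, i.e. with letters and positions `0, …, n - 1`. -/
def lis {n : ℕ} (π : Equiv.Perm (Fin n)) : ℕ :=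
  (Finset.univ.filter fun s : Finset (Fin n) =>
    ∀ i ∈ s, ∀ j ∈ s, i < j → π i < π j).sup Finset.card

/-- `L n k`: the permutations whose longest increasing subsequences have length `k`. -/
def L (n k : ℕ) : Set (Equiv.Perm (Fin n)) := {π | lis π = k}

/-- `I n k`: the involutions (square equal to the identity) whose longest increasing subsequences
have length `k`. -/
def I (n k : ℕ) : Set (Equiv.Perm (Fin n)) := {π | π ^ 2 = 1 ∧ lis π = k}

/-- A (finite) tableau, given as the list of its rows from top to bottom. -/
abbrev Tableau : Type := List (List ℕ)

/-- The shape of a tableau: the list of its row lengths. -/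
def Tableau.sh (T : Tableau) : List ℕ := T.map List.length

/-- Insertion of `x` into a row: `x` replaces the leftmost entry greater than `x`, which is
returned as the bumped entry; if there is no such entry, `x` is put at the end of the row. -/
def rowInsert (x : ℕ) : List ℕ → List ℕ × Option ℕ
  | [] => ([x], none)
  | y :: r => if x < y then (x :: r, some y) else (y :: (rowInsert x r).1, (rowInsert x r).2)

/-- Schensted insertion of `x` into a tableau: insert `x` into the first row, and insert the bumped
entry, if there is one, into the tableau formed by the remaining rows. -/
def tabInsert (x : ℕ) : Tableau → Tableau
  | [] => [[x]]
  | r :: T =>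
    match (rowInsert x r).2 with
    | none => (rowInsert x r).1 :: T
    | some y => (rowInsert x r).1 :: tabInsert y T

/-- `record i Q P` puts the label `i` at the end of the first row of `Q` that is shorter than the
corresponding row of `P`. If `sh P` arises from `sh Q` by adding one cell, this is the cell where
`i` is put. -/
def record (i : ℕ) : Tableau → Tableau → Tableau
  | [], _ => [[i]]
  | q :: Q, [] => q :: Q
  | q :: Q, p :: P => if q.length < p.length then (q ++ [i]) :: Q else q :: record i Q P

/-- One step of the Robinson-Schensted algorithm: the letter `x` is inserted into the insertion
tableau, and its position `i` is recorded in the cell that was added. -/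
def rsStep (PQ : Tableau × Tableau) (i x : ℕ) : Tableau × Tableau :=
  (tabInsert x PQ.1, record i PQ.2 (tabInsert x PQ.1))

/-- The Robinson-Schensted map `π ↦ (P, Q)`: insert the letters of the one-line notation of `π`
from left to right, starting from the pair of empty tableaux. -/
def RS {n : ℕ} (π : Equiv.Perm (Fin n)) : Tableau × Tableau :=
  (List.finRange n).foldl (fun PQ (i : Fin n) => rsStep PQ i (π i)) ([], [])

/-- The shape of a permutation: the shape of its insertion tableau `P` (by construction also the
shape of `Q`). -/
def sh {n : ℕ} (π : Equiv.Perm (Fin n)) : List ℕ := (RS π).1.sh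

/-- The shape of a pair of permutations. -/
def pairSh {n : ℕ} (p : Equiv.Perm (Fin n) × Equiv.Perm (Fin n)) : List ℕ × List ℕ :=
  (sh p.1, sh p.2)

/-- A map `F : A × B → C × C` between sets of pairs of permutations is shape preserving if the
shape of `F (π, π')` depends only on the shape of `(π, π')`. -/
def ShapePreserving {n : ℕ} {A B C : Set (Equiv.Perm (Fin n))} (F : A × B → C × C) : Prop :=
  ∀ p q : A × B,
    pairSh (p.1.1, p.2.1) = pairSh (q.1.1, q.2.1) →
      pairSh ((F p).1.1, (F p).2.1) = pairSh ((F q).1.1, (F q).2.1)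

/-- The finite sequence `l 1, …, l n` is log concave: `l (k - 1) * l (k + 1) ≤ l k ^ 2` for
`1 ≤ k ≤ n`, with the convention that the terms with index `0` and `n + 1` are zero. -/
def LogConcave (n : ℕ) (l : ℕ → ℝ) : Prop :=
  ∀ k ∈ Finset.Icc 1 n,
    (if k - 1 = 0 then 0 else l (k - 1)) * (if k + 1 = n + 1 then 0 else l (k + 1)) ≤ l k ^ 2

end IncSubseq

/-!
The Robinson-Schensted map is a bijection from permutations to pairs of standard tableaux of the
same shape, inversion exchanges the two tableaux, and the first row of the shape has length `lis`.
Hence involutions are the permutations with equal tableaux, and a permutation `π` amounts to two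
involutions of shape `sh π`: one for its recording tableau and one for its insertion tableau. Given
`(π, π')`, apply `f` once to the involutions of the two recording tableaux and once to those of the
two insertion tableaux. As `f` preserves shapes, the two results have the same shapes, so they can
be recombined into a pair of permutations (`combine`). This map is injective and preserves shapes,
and the lengths of the longest increasing subsequences are right because the shape determines them.

The facts about the Robinson-Schensted map are proved with growth diagrams in which only the edges
of the grid are labelled, with the row in which the partitions at the two ends differ
(`CellRule`, `IsGrowth`). A row insertion into a tableau whose largest entry is `j` either leaves
`j` alone or moves it down one row (`tabInsert_appendAt`), so the shapes of the insertion tableaux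
of the letters less than `j` among the first `i` letters obey the local rule
(`isGrowth_of_injective`). Everything then follows from the rule:

* it is symmetric, which gives the symmetry under inversion (`labels_inv`);
* it is a bijection between the lower left and the upper right data of a cell, so the labels on the
  top and right sides of the grid, which encode the two tableaux, determine the permutation
  (`perm_eq_of_labels`); and running it backwards from tableaux of equal shapes keeps partitions at
  all corners, which forces empty labels on the bottom and left sides (`exists_perm_of_sh_eq`);
* the first rows satisfy the recursion of the longest increasing subsequences
  (`partAt_zero_eq_longest`).
-/

namespace IncSubseq

/-! ### Growth diagrams with labelled edges -/

/-- The local rule of a growth diagram, for a cell that carries a point if and only if `p` holds.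
The labels `a`, `b`, `a'`, `b'` belong to the bottom, left, top and right edge of the cell. The
label `some r` on an edge says that the partitions at its two ends differ by a cell in row `r`; the
label `none` says that they agree. -/
inductive CellRule (p : Prop) : Option ℕ → Option ℕ → Option ℕ → Option ℕ → Prop
  | point (hp : p) : CellRule p none none (some 0) (some 0)
  | bump (hp : ¬p) (a : Option ℕ) : CellRule p a a (a.map (· + 1)) (a.map (· + 1))
  | cross (hp : ¬p) {a b : Option ℕ} (h : a ≠ b) : CellRule p a b a b

/-- The number of cells that an edge with label `a` adds to row `r`. -/
def cellCount (a : Option ℕ) (r : ℕ) : ℤ := if a = some r then 1 else 0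

theorem CellRule.outputs_unique {p q : Prop} {a b a₁ b₁ a₂ b₂ : Option ℕ} (hpq : p ↔ q)
    (h₁ : CellRule p a b a₁ b₁) (h₂ : CellRule q a b a₂ b₂) : a₁ = a₂ ∧ b₁ = b₂ := by
  cases h₁ <;> cases h₂ <;> simp_all

theorem CellRule.inputs_unique {p q : Prop} {a₁ b₁ a₂ b₂ a b : Option ℕ}
    (h₁ : CellRule p a₁ b₁ a b) (h₂ : CellRule q a₂ b₂ a b) :
    (p ↔ q) ∧ a₁ = a₂ ∧ b₁ = b₂ := by
  generalize ha : a = a' at h₂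
  generalize hb : b = b' at h₂
  cases h₁ with
  | point hp => cases h₂ with
    | point hq => simp [hp, hq]
    | bump hq => cases a₂ <;> simp at ha
    | cross hq h => exact absurd (ha.symm.trans hb) h
  | bump hp => cases h₂ with
    | point hq => cases a₁ <;> simp at ha
    | bump hq => cases a₁ <;> cases a₂ <;> simp_all
    | cross hq h => exact absurd (ha.symm.trans hb) h
  | cross hp h => cases h₂ with
    | point hq => exact absurd (ha.trans hb.symm) h
    | bump hq => exact absurd (ha.trans hb.symm) h
    | cross hq h' => simp [hp, hq, ha, hb]

theorem CellRule.symm {p : Prop} {a b a' b' : Option ℕ} (h : CellRule p a b a' b') :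
    CellRule p b a b' a' := by
  cases h with
  | point hp => exact .point hp
  | bump hp a => exact .bump hp a
  | cross hp h => exact .cross hp h.symm

/-- The two paths from the lower left to the upper right corner of a cell add the same cells. -/
theorem CellRule.cellCount_add {p : Prop} {a b a' b' : Option ℕ} (h : CellRule p a b a' b')
    (r : ℕ) : cellCount a r + cellCount b' r = cellCount b r + cellCount a' r := by
  cases h <;> ring

theorem cellCount_nonneg (a : Option ℕ) (r : ℕ) : 0 ≤ cellCount a r := by
  unfold cellCount
  split_ifs <;> norm_num

/-- Without a point, at most one of the top and right edges of a cell adds to the first row. -/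
theorem CellRule.cellCount_zero_eq_zero {p : Prop} {a b a' b' : Option ℕ} (h : CellRule p a b a' b')
    (hp : ¬p) : cellCount a' 0 = 0 ∨ cellCount b' 0 = 0 := by
  cases h with
  | point h => exact absurd h hp
  | bump _ a => cases a <;> simp [cellCount]
  | cross _ h =>
    by_contra! hc
    have h₁ : a = some 0 := by by_contra hn; simp [cellCount, hn] at hc
    have h₂ : b = some 0 := by by_contra hn; simp [cellCount, hn] at hc
    exact h (h₁.trans h₂.symm)

theorem CellRule.right_eq_some_zero {p : Prop} {a b a' b' : Option ℕ}
    (h : CellRule p a b a' b') (hp : p) : b' = some 0 := by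
  cases h <;> simp_all

theorem CellRule.top_ne_none {p : Prop} {a b a' b' : Option ℕ} (h : CellRule p a b a' b')
    (ha : p ∨ a ≠ none) : a' ≠ none := by
  cases h <;> simp_all

theorem CellRule.top_eq_none {p : Prop} {a b a' b' : Option ℕ} (h : CellRule p a b a' b')
    (hp : ¬p) (ha : a = none) : a' = none := by
  cases h <;> simp_all

theorem CellRule.bottom_eq_none {p : Prop} {a b a' b' : Option ℕ} (h : CellRule p a b a' b')
    (hp : p) : a = none := by
  cases h <;> simp_all

/-- The row lengths `S 0, S 1, …` form a partition: they are nonnegative and weakly decreasing.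
Integers are used so that cells may be subtracted freely. -/
def IsPart (S : ℕ → ℤ) : Prop := ∀ r, 0 ≤ S r ∧ S (r + 1) ≤ S r

theorem isPart_zero : IsPart fun _ => 0 := fun _ => by simp

/-- If three corners of a cell carry partitions, so does the upper right one. -/
theorem CellRule.isPart_upper {p : Prop} {a b a' b' : Option ℕ} (h : CellRule p a b a' b')
    {S S₁ S₂ S₃ : ℕ → ℤ} (hS : IsPart S) (hS₁ : IsPart S₁) (hS₂ : IsPart S₂)
    (h₁ : ∀ r, S₁ r = S r + cellCount a r) (h₂ : ∀ r, S₂ r = S r + cellCount b r)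
    (h₃ : ∀ r, S₃ r = S₁ r + cellCount b' r) : IsPart S₃ := by
  intro r
  have e₁ := h₁ r; have e₁' := h₁ (r + 1)
  have e₂ := h₂ r; have e₂' := h₂ (r + 1)
  have e₃ := h₃ r; have e₃' := h₃ (r + 1)
  have p₀ := hS r; have p₁ := hS₁ r; have p₂ := hS₂ r
  cases h with
  | point hp =>
    rcases r with _ | r <;> simp [cellCount] at * <;> omega
  | bump hp a =>
    rcases a with _ | t
    · simp [cellCount] at *; omega
    · simp only [cellCount, Option.map_some, Option.some.injEq] at *
      split_ifs at * <;> omega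
  | cross hp hab =>
    rcases a with _ | s <;> rcases b with _ | t <;> simp [cellCount] at * <;>
      split_ifs at * <;> omega

/-- If three corners of a cell carry partitions, so does the lower left one. -/
theorem CellRule.isPart_lower {p : Prop} {a b a' b' : Option ℕ} (h : CellRule p a b a' b')
    {S S₁ S₂ S₃ : ℕ → ℤ} (hS₁ : IsPart S₁) (hS₂ : IsPart S₂) (hS₃ : IsPart S₃)
    (h₁ : ∀ r, S₁ r = S r + cellCount a r) (h₂ : ∀ r, S₂ r = S r + cellCount b r)
    (h₃ : ∀ r, S₃ r = S₁ r + cellCount b' r) : IsPart S := by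
  intro r
  have e₁ := h₁ r; have e₁' := h₁ (r + 1)
  have e₂ := h₂ r; have e₂' := h₂ (r + 1)
  have e₃ := h₃ r; have e₃' := h₃ (r + 1)
  have p₁ := hS₁ r; have p₂ := hS₂ r; have p₃ := hS₃ r
  have q₁ := hS₁ (r + 1)
  cases h with
  | point hp =>
    rcases r with _ | r <;> simp [cellCount] at * <;> omega
  | bump hp a =>
    rcases a with _ | t
    · simp [cellCount] at *; omega
    · simp only [cellCount, Option.map_some, Option.some.injEq] at *
      split_ifs at * <;> omega
  | cross hp hab =>
    rcases a with _ | s <;> rcases b with _ | t <;> simp [cellCount] at * <;>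
      split_ifs at * <;> omega

/-- `IsGrowth n p A B`: the labels `A` and `B` form the growth diagram of the set `p` of points in
the `n × n` grid. `A i j` labels the horizontal edge from `(i, j)` to `(i + 1, j)`, and `B i j` the
vertical edge from `(i, j)` to `(i, j + 1)`. Labels outside the grid are irrelevant. -/
structure IsGrowth (n : ℕ) (p : ℕ → ℕ → Prop) (A B : ℕ → ℕ → Option ℕ) : Prop where
  bottom : ∀ i < n, A i 0 = none
  left : ∀ j < n, B 0 j = none
  cell : ∀ i < n, ∀ j < n, CellRule (p i j) (A i j) (B i j) (A i (j + 1)) (B (i + 1) j)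

/-- The partition at the point `(i, j)` of a growth diagram with horizontal labels `A`, as the
function of its row lengths. -/
def partAt (A : ℕ → ℕ → Option ℕ) (i j r : ℕ) : ℤ := ∑ i' ∈ Finset.range i, cellCount (A i' j) r

theorem partAt_succ_left (A : ℕ → ℕ → Option ℕ) (i j r : ℕ) :
    partAt A (i + 1) j r = partAt A i j r + cellCount (A i j) r :=
  Finset.sum_range_succ _ _

variable {n : ℕ} {p q : ℕ → ℕ → Prop} {A B A' B' : ℕ → ℕ → Option ℕ}

namespace IsGrowth

theorem flip (h : IsGrowth n p A B) :
    IsGrowth n (fun i j => p j i) (fun i j => B j i) (fun i j => A j i) :=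
  ⟨h.left, h.bottom, fun i hi j hj => (h.cell j hj i hi).symm⟩

theorem partAt_zero_right (h : IsGrowth n p A B) {i : ℕ} (hi : i ≤ n) (r : ℕ) :
    partAt A i 0 r = 0 := by
  refine Finset.sum_eq_zero fun i' hi' => ?_
  rw [h.bottom i' (by have := Finset.mem_range.1 hi'; omega)]
  simp [cellCount]

theorem partAt_succ_right (h : IsGrowth n p A B) {i j : ℕ} (hi : i ≤ n) (hj : j < n) (r : ℕ) :
    partAt A i (j + 1) r = partAt A i j r + cellCount (B i j) r := by
  induction i with
  | zero => simp [partAt, h.left j hj, cellCount]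
  | succ i ih =>
    have := (h.cell i hi j hj).cellCount_add r
    rw [partAt_succ_left, partAt_succ_left, ih (by omega)]
    linarith

theorem partAt_eq_sum_right (h : IsGrowth n p A B) {j : ℕ} (hj : j ≤ n) (r : ℕ) :
    partAt A n j r = ∑ j' ∈ Finset.range j, cellCount (B n j') r := by
  induction j with
  | zero => simpa using h.partAt_zero_right le_rfl r
  | succ j ih => rw [h.partAt_succ_right le_rfl hj, ih (by omega), Finset.sum_range_succ]

theorem isPart (h : IsGrowth n p A B) {i j : ℕ} (hi : i ≤ n) (hj : j ≤ n) :
    IsPart (partAt A i j) := by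
  induction i generalizing j with
  | zero => exact isPart_zero
  | succ i ih =>
    induction j with
    | zero =>
      have : partAt A (i + 1) 0 = fun _ => 0 := funext fun r => h.partAt_zero_right hi r
      exact this ▸ isPart_zero
    | succ j ihj =>
      exact (h.cell i hi j hj).isPart_upper (ih (by omega) (by omega)) (ihj (by omega))
        (ih (by omega) hj) (partAt_succ_left A i j) (h.partAt_succ_right (by omega) hj)
        (h.partAt_succ_right hi hj)

/-- The points determine the labels. -/
theorem labels_unique (h : IsGrowth n p A B) (h' : IsGrowth n p A' B') {i : ℕ} (hi : i ≤ n) :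
    (∀ j < n, B i j = B' i j) ∧ (i < n → ∀ j ≤ n, A i j = A' i j) := by
  have row : ∀ i < n, (∀ j < n, B i j = B' i j) → ∀ j ≤ n, A i j = A' i j := by
    intro i hi hB j
    induction j with
    | zero => intro _; rw [h.bottom i hi, h'.bottom i hi]
    | succ j ih =>
      intro hj
      have c := h.cell i hi j hj
      rw [ih (by omega), hB j hj] at c
      exact (c.outputs_unique Iff.rfl (h'.cell i hi j hj)).1
  have hB : ∀ j < n, B i j = B' i j := by
    induction i with
    | zero => intro j hj; rw [h.left j hj, h'.left j hj]
    | succ i ih =>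
      intro j hj
      have hBi := ih (by omega)
      have c := h.cell i hi j hj
      rw [row i hi hBi j hj.le, hBi j hj] at c
      exact (c.outputs_unique Iff.rfl (h'.cell i hi j hj)).2
  exact ⟨hB, fun hi => row i hi hB⟩

/-- The labels on the top and right sides of the grid determine the points. -/
theorem points_unique (h : IsGrowth n p A B) (h' : IsGrowth n q A' B')
    (htop : ∀ i < n, A i n = A' i n) (hright : ∀ j < n, B n j = B' n j) :
    ∀ i < n, ∀ j < n, (p i j ↔ q i j) := by
  have row : ∀ i < n, (∀ j < n, B (i + 1) j = B' (i + 1) j) →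
      ∀ c j, j + c = n → A i j = A' i j := by
    intro i hi hB c
    induction c with
    | zero => rintro j rfl; exact htop i hi
    | succ c ih =>
      intro j hj
      have r := h.cell i hi j (by omega)
      rw [ih (j + 1) (by omega), hB j (by omega)] at r
      exact (r.inputs_unique (h'.cell i hi j (by omega))).2.1
  have hB : ∀ d i, i + d = n → ∀ j < n, B i j = B' i j := by
    intro d
    induction d with
    | zero => rintro i rfl; exact hright
    | succ d ih =>
      intro i hi j hj
      have hB := ih (i + 1) (by omega)
      have r := h.cell i (by omega) j hj
      rw [row i (by omega) hB (n - (j + 1)) (j + 1) (by omega), hB j hj] at r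
      exact (r.inputs_unique (h'.cell i (by omega) j hj)).2.2
  intro i hi j hj
  have hBi := hB (n - (i + 1)) (i + 1) (by omega)
  have r := h.cell i hi j hj
  rw [row i hi hBi (n - (j + 1)) (j + 1) (by omega), hBi j hj] at r
  exact (r.inputs_unique (h'.cell i hi j hj)).1

theorem top_ne_none (h : IsGrowth n p A B) {i j k : ℕ} (hi : i < n) (hp : p i j)
    (hjk : j < k) (hk : k ≤ n) : A i k ≠ none := by
  induction k, hjk using Nat.le_induction with
  | base => exact (h.cell i hi j hk).top_ne_none (Or.inl hp)
  | succ k hjk ih => exact (h.cell i hi k hk).top_ne_none (Or.inr (ih (by omega)))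

/-- A column of the grid contains at most one point. -/
theorem point_unique (h : IsGrowth n p A B) {i j k : ℕ} (hi : i < n) (hj : j < n) (hk : k < n)
    (hpj : p i j) (hpk : p i k) : j = k := by
  rcases lt_trichotomy j k with hjk | hjk | hjk
  · exact absurd ((h.cell i hi k hk).bottom_eq_none hpk) (h.top_ne_none hi hpj hjk hk.le)
  · exact hjk
  · exact absurd ((h.cell i hi j hj).bottom_eq_none hpj) (h.top_ne_none hi hpk hjk hj.le)

theorem exists_point (h : IsGrowth n p A B) {i : ℕ} (hi : i < n) (htop : A i n ≠ none) :
    ∃ j < n, p i j := by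
  by_contra! hno
  have : ∀ j ≤ n, A i j = none := by
    intro j
    induction j with
    | zero => exact fun _ => h.bottom i hi
    | succ j ih =>
      exact fun hj => (h.cell i hi j hj).top_eq_none (hno j hj) (ih (by omega))
  exact htop (this n le_rfl)

end IsGrowth

/-! ### Running the local rule backwards -/

/-- The label of the row one step higher in the tableau; `some 0`, which comes from a point, and
`none` give `none`. -/
def lowerLabel : Option ℕ → Option ℕ
  | some (r + 1) => some r
  | _ => none

/-- The bottom and left labels of a cell, recovered from the top and right labels. -/
def backStep (a b : Option ℕ) : Option ℕ × Option ℕ :=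
  if a = b then (lowerLabel a, lowerLabel b) else (a, b)

theorem cellRule_backStep (a b : Option ℕ) :
    CellRule (a = some 0 ∧ b = some 0) (backStep a b).1 (backStep a b).2 a b := by
  by_cases h : a = b
  · subst h
    simp only [backStep, if_true]
    rcases a with _ | _ | r
    · exact .bump (by simp) none
    · exact .point (by simp)
    · exact .bump (by simp) (some r)
  · simp only [backStep, if_neg h]
    exact .cross (fun hab => h (hab.1.trans hab.2.symm)) h

/-- The labels of the vertical edges in a row of cells, counted from the right: `a` gives the top
labels of the row and `b` is the rightmost vertical label. -/
def backVert (a : ℕ → Option ℕ) (b : Option ℕ) : ℕ → Option ℕ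
  | 0 => b
  | u + 1 => (backStep (a u) (backVert a b u)).2

/-- The labels of the horizontal edges at depth `v` below the top side of the grid, counted from
the right, when the top labels are `a` and the labels on the right side, counted from the top, are
`b`. -/
def backHor (a b : ℕ → Option ℕ) : ℕ → ℕ → Option ℕ
  | 0 => a
  | v + 1 => fun u => (backStep (backHor a b v u) (backVert (backHor a b v) (b v) u)).1

/-- The local rule may be run backwards from the upper right corner. If the labels on the top and
right sides come from two growth diagrams with the same final partition, all corners carry
partitions, so the labels on the bottom and left sides vanish and the result is a growth diagram. -/
theorem exists_growth_of_partAt_eq (h : IsGrowth n p A B) (h' : IsGrowth n q A' B')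
    (hpart : ∀ r, partAt A n n r = partAt A' n n r) :
    ∃ (p'' : ℕ → ℕ → Prop) (A'' B'' : ℕ → ℕ → Option ℕ), IsGrowth n p'' A'' B'' ∧
      (∀ i < n, A'' i n = A i n) ∧ ∀ j < n, B'' n j = B' n j := by
  set a : ℕ → Option ℕ := fun u => A (n - 1 - u) n with ha
  set b : ℕ → Option ℕ := fun v => B' n (n - 1 - v) with hb
  set U : ℕ → ℕ → Option ℕ := fun u v => backHor a b v u with hU
  set V : ℕ → ℕ → Option ℕ := fun u v => backVert (backHor a b v) (b v) u with hV
  have rule : ∀ u v, CellRule (U u v = some 0 ∧ V u v = some 0)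
      (U u (v + 1)) (V (u + 1) v) (U u v) (V u v) := fun u v => cellRule_backStep (U u v) (V u v)
  -- `S u v` are the row lengths at distance `u` from the right and `v` from the top.
  set S : ℕ → ℕ → ℕ → ℤ := fun u v r =>
    partAt A' n (n - v) r - ∑ u' ∈ Finset.range u, cellCount (U u' v) r with hS
  have S_left : ∀ u v r, S u v r = S (u + 1) v r + cellCount (U u v) r := by
    intro u v r
    simp only [hS, Finset.sum_range_succ]
    ring
  have S_down : ∀ u v, v < n → ∀ r, S u v r = S u (v + 1) r + cellCount (V u v) r := by
    intro u v hv r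
    induction u with
    | zero =>
      have := h'.partAt_succ_right (i := n) (j := n - 1 - v) le_rfl (by omega) r
      rw [show n - 1 - v + 1 = n - v by omega] at this
      simp only [hS, Finset.range_zero, Finset.sum_empty, sub_zero]
      rw [this, show n - (v + 1) = n - 1 - v by omega]
      rfl
    | succ u ih =>
      have := (rule u v).cellCount_add r
      linarith [S_left u v r, S_left u (v + 1) r]
  have S_top : ∀ u ≤ n, ∀ r, S u 0 r = partAt A (n - u) n r := by
    intro u hu r
    induction u with
    | zero => simp [hS, hpart]
    | succ u ih =>
      have e := partAt_succ_left A (n - 1 - u) n r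
      rw [show n - 1 - u + 1 = n - u by omega] at e
      have e' := S_left u 0 r
      rw [ih (by omega), e] at e'
      rw [show n - (u + 1) = n - 1 - u by omega]
      have : U u 0 = A (n - 1 - u) n := rfl
      rw [this] at e'
      linarith
  have S_right : ∀ v r, S 0 v r = partAt A' n (n - v) r := by simp [hS]
  have S_part : ∀ v ≤ n, ∀ u ≤ n, IsPart (S u v) := by
    intro v
    induction v with
    | zero =>
      intro _ u hu
      rw [show S u 0 = partAt A (n - u) n from funext (S_top u hu)]
      exact h.isPart (by omega) le_rfl
    | succ v ihv =>
      intro hv u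
      induction u with
      | zero =>
        intro _
        rw [show S 0 (v + 1) = partAt A' n (n - (v + 1)) from funext (S_right (v + 1))]
        exact h'.isPart le_rfl (by omega)
      | succ u ihu =>
        intro hu
        exact (rule u v).isPart_lower (ihu (by omega)) (ihv (by omega) (u + 1) hu)
          (ihv (by omega) u (by omega)) (S_left u (v + 1)) (S_down (u + 1) v hv) (S_down u v hv)
  have none_of : ∀ (c : Option ℕ) (X Y : ℕ → ℤ), IsPart X → (∀ r, Y r = 0) →
      (∀ r, Y r = X r + cellCount c r) → c = none := by
    intro c X Y hX hY hXY
    rcases c with _ | r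
    · rfl
    · have h₁ := (hX r).1
      have h₂ := hXY r
      rw [hY r] at h₂
      simp only [cellCount, if_true] at h₂
      omega
  -- The partitions on the left and bottom sides are empty.
  have V_left : ∀ v < n, V n v = none := by
    have zero : ∀ v ≤ n, ∀ r, S n v r = 0 := by
      intro v
      induction v with
      | zero => intro _ r; rw [S_top n le_rfl]; simp [partAt]
      | succ v ih =>
        intro hv r
        have e := S_down n v hv r
        have := (S_part (v + 1) hv n le_rfl r).1
        rw [ih (by omega) r] at e
        have := cellCount_nonneg (V n v) r
        linarith
    exact fun v hv => none_of _ _ _ (S_part (v + 1) hv n le_rfl) (zero v hv.le) (S_down n v hv)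
  have U_bottom : ∀ u < n, U u n = none := by
    have zero : ∀ u ≤ n, ∀ r, S u n r = 0 := by
      intro u
      induction u with
      | zero => intro _ r; rw [S_right, Nat.sub_self, h'.partAt_zero_right le_rfl]
      | succ u ih =>
        intro hu r
        have e := S_left u n r
        have := (S_part n le_rfl (u + 1) hu r).1
        rw [ih (by omega) r] at e
        have := cellCount_nonneg (U u n) r
        linarith
    exact fun u hu => none_of _ _ _ (S_part n le_rfl (u + 1) hu) (zero u hu.le) (S_left u n)
  refine ⟨fun i j => U (n - 1 - i) (n - 1 - j) = some 0 ∧ V (n - 1 - i) (n - 1 - j) = some 0,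
    fun i j => U (n - 1 - i) (n - j), fun i j => V (n - i) (n - 1 - j), ⟨?_, ?_, ?_⟩, ?_, ?_⟩
  · exact fun i hi => U_bottom _ (by omega)
  · exact fun j hj => V_left _ (by omega)
  · intro i hi j hj
    have := rule (n - 1 - i) (n - 1 - j)
    rw [show n - 1 - i + 1 = n - i by omega, show n - 1 - j + 1 = n - j by omega] at this
    rwa [show n - (j + 1) = n - 1 - j by omega, show n - (i + 1) = n - 1 - i by omega]
  · intro i hi
    have : U (n - 1 - i) (n - n) = A (n - 1 - (n - 1 - i)) n := by rw [Nat.sub_self]; rfl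
    rwa [show n - 1 - (n - 1 - i) = i by omega] at this
  · intro j hj
    have : V (n - n) (n - 1 - j) = B' n (n - 1 - (n - 1 - j)) := by rw [Nat.sub_self]; rfl
    rwa [show n - 1 - (n - 1 - j) = j by omega] at this

/-! ### Row insertion and the local rule -/

/-- The row in which the insertion of `x` into `T` adds a cell. -/
def insertRow (x : ℕ) : Tableau → ℕ
  | [] => 0
  | r :: T =>
    match (rowInsert x r).2 with
    | none => 0
    | some y => insertRow y T + 1

/-- The tableau `T` with the entry `j` put at the end of row `s`. If `T` has no row `s`, a row is
added; this is meant to be used for `s ≤ T.length` only. -/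
def appendAt (j : ℕ) : ℕ → Tableau → Tableau
  | _, [] => [[j]]
  | 0, r :: T => (r ++ [j]) :: T
  | s + 1, r :: T => r :: appendAt j s T

/-- The length of row `r` of a tableau, which is `0` if there is no such row. -/
def Tableau.rowLen (T : Tableau) (r : ℕ) : ℕ := T.sh.getD r 0

/-- All entries of the tableau are less than `j`. -/
def Tableau.EntriesLT (T : Tableau) (j : ℕ) : Prop := ∀ r ∈ T, ∀ y ∈ r, y < j

@[simp] theorem Tableau.rowLen_nil (r : ℕ) : Tableau.rowLen [] r = 0 := by
  simp [Tableau.rowLen, Tableau.sh]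

@[simp] theorem Tableau.rowLen_cons_zero (q : List ℕ) (T : Tableau) :
    Tableau.rowLen (q :: T) 0 = q.length := rfl

@[simp] theorem Tableau.rowLen_cons_succ (q : List ℕ) (T : Tableau) (r : ℕ) :
    Tableau.rowLen (q :: T) (r + 1) = T.rowLen r := by
  simp [Tableau.rowLen, Tableau.sh]

theorem length_rowInsert (x : ℕ) (q : List ℕ) :
    (rowInsert x q).1.length = q.length + if (rowInsert x q).2 = none then 1 else 0 := by
  induction q with
  | nil => simp [rowInsert]
  | cons y q ih =>
    by_cases h : x < y
    · simp [rowInsert, h]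
    · simp only [rowInsert, if_neg h, List.length_cons, ih]
      omega

theorem rowLen_tabInsert (x : ℕ) (T : Tableau) (r : ℕ) :
    (tabInsert x T).rowLen r = T.rowLen r + if insertRow x T = r then 1 else 0 := by
  induction T generalizing x r with
  | nil => cases r <;> simp [tabInsert, insertRow]
  | cons q T ih =>
    have hl := length_rowInsert x q
    rcases hx : (rowInsert x q).2 with _ | y <;> rw [hx] at hl
    · cases r <;> simp [tabInsert, insertRow, hx, hl]
    · cases r <;> simp [tabInsert, insertRow, hx, hl, ih]

theorem length_tabInsert (x : ℕ) (T : Tableau) :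
    T.length ≤ (tabInsert x T).length ∧ insertRow x T < (tabInsert x T).length := by
  induction T generalizing x with
  | nil => simp [tabInsert, insertRow]
  | cons q T ih =>
    rcases hx : (rowInsert x q).2 with _ | y
    · simp [tabInsert, insertRow, hx]
    · have := ih y
      simp only [tabInsert, insertRow, hx, List.length_cons]
      omega

theorem rowInsert_lt {x j : ℕ} {q : List ℕ} (hx : x < j) (hq : ∀ y ∈ q, y < j) :
    (∀ y ∈ (rowInsert x q).1, y < j) ∧ ∀ y ∈ (rowInsert x q).2, y < j := by
  induction q with
  | nil => simpa [rowInsert] using hx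
  | cons y q ih =>
    have hy := hq y (by simp)
    have hq' : ∀ z ∈ q, z < j := fun z hz => hq z (by simp [hz])
    by_cases h : x < y
    · simpa [rowInsert, h, hx, hy] using hq'
    · simpa [rowInsert, h, hy] using ih hq'

theorem Tableau.EntriesLT.tabInsert {x j : ℕ} {T : Tableau} (hT : T.EntriesLT j) (hx : x < j) :
    (tabInsert x T).EntriesLT j := by
  induction T generalizing x with
  | nil => simpa [IncSubseq.tabInsert, Tableau.EntriesLT] using hx
  | cons q T ih =>
    have hq := rowInsert_lt hx (hT q (by simp))
    have hT' : Tableau.EntriesLT T j := fun r hr => hT r (by simp [hr])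
    rcases h : (rowInsert x q).2 with _ | y
    · simp only [IncSubseq.tabInsert, h, Tableau.EntriesLT, List.forall_mem_cons]
      exact ⟨hq.1, hT'⟩
    · simp only [IncSubseq.tabInsert, h, Tableau.EntriesLT, List.forall_mem_cons]
      exact ⟨hq.1, ih hT' (hq.2 y h)⟩

theorem rowInsert_append_of_some {x j y : ℕ} {q : List ℕ} (h : (rowInsert x q).2 = some y) :
    rowInsert x (q ++ [j]) = ((rowInsert x q).1 ++ [j], some y) := by
  induction q with
  | nil => simp [rowInsert] at h
  | cons z q ih =>
    by_cases hz : x < z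
    · simp_all [rowInsert]
    · simp only [rowInsert, if_neg hz] at h
      simp [rowInsert, hz, ih h]

theorem rowInsert_append_of_none {x j : ℕ} {q : List ℕ} (hx : x < j)
    (h : (rowInsert x q).2 = none) :
    rowInsert x (q ++ [j]) = ((rowInsert x q).1, some j) := by
  induction q with
  | nil => simp [rowInsert, hx]
  | cons z q ih =>
    by_cases hz : x < z
    · simp [rowInsert, hz] at h
    · simp only [rowInsert, if_neg hz] at h
      simp [rowInsert, hz, ih h]

theorem rowInsert_of_forall_lt {j : ℕ} {q : List ℕ} (hq : ∀ y ∈ q, y < j) :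
    rowInsert j q = (q ++ [j], none) := by
  induction q with
  | nil => rfl
  | cons z q ih =>
    have hz := hq z (by simp)
    simp [rowInsert, hz.le.not_gt, ih fun y hy => hq y (by simp [hy])]

/-- A letter that exceeds all entries is put at the end of the first row. -/
theorem tabInsert_of_entriesLT {j : ℕ} {T : Tableau} (hT : T.EntriesLT j) :
    tabInsert j T = appendAt j 0 T ∧ insertRow j T = 0 := by
  cases T with
  | nil => simp [tabInsert, appendAt, insertRow]
  | cons q T =>
    have := rowInsert_of_forall_lt (hT q (by simp))
    simp [tabInsert, appendAt, insertRow, this]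

/-- Insertion of a letter `x` into a tableau with largest entry `j`, at the end of row `s`: the
entry `j` stays where it is unless its place is needed for the new cell, in which case `j` is
bumped to the end of the next row. -/
theorem tabInsert_appendAt {x j s : ℕ} {T : Tableau} (hT : T.EntriesLT j) (hx : x < j)
    (hs : s ≤ T.length) :
    tabInsert x (appendAt j s T) =
        appendAt j (if insertRow x T = s then s + 1 else s) (tabInsert x T) ∧
      insertRow x (appendAt j s T) = if insertRow x T = s then s + 1 else insertRow x T := by
  induction T generalizing x s with
  | nil =>
    obtain rfl : s = 0 := by simpa using hs
    simp [appendAt, tabInsert, insertRow, rowInsert, hx]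
  | cons q T ih =>
    have hq := rowInsert_lt hx (hT q (by simp))
    have hT' : Tableau.EntriesLT T j := fun r hr => hT r (by simp [hr])
    rcases h : (rowInsert x q).2 with _ | y
    · cases s with
      | zero =>
        have := tabInsert_of_entriesLT hT'
        simp [appendAt, tabInsert, insertRow, h, rowInsert_append_of_none hx h, this]
      | succ s => simp [appendAt, tabInsert, insertRow, h]
    · cases s with
      | zero => simp [appendAt, tabInsert, insertRow, h, rowInsert_append_of_some h]
      | succ s =>
        have := ih hT' (hq.2 y h) (s := s) (by simpa using hs)
        by_cases hr : insertRow y T = s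
        · simp [appendAt, tabInsert, insertRow, h, this, hr]
        · simp [appendAt, tabInsert, insertRow, h, this, hr]

/-- The insertion tableau of those of the first `i` letters of the word `w` that are less
than `j`. -/
def restrictedTableau (w : ℕ → ℕ) (j : ℕ) : ℕ → Tableau
  | 0 => []
  | i + 1 => if w i < j then tabInsert (w i) (restrictedTableau w j i) else restrictedTableau w j i

/-- The row in which the `i`-th letter of `w` adds a cell to the tableau of letters less
than `j`. -/
def horLabel (w : ℕ → ℕ) (i j : ℕ) : Option ℕ :=
  if w i < j then some (insertRow (w i) (restrictedTableau w j i)) else none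

/-- The row that contains the letter `j` after `i` steps of the insertion of `w`, or `none` if
`j` has not been inserted yet. The definition follows the local rule; `restrictedTableau_succ`
justifies it. -/
def vertLabel (w : ℕ → ℕ) (j : ℕ) : ℕ → Option ℕ
  | 0 => none
  | i + 1 =>
    if w i = j then some 0
    else if horLabel w i j = vertLabel w j i then (vertLabel w j i).map (· + 1)
    else vertLabel w j i

theorem entriesLT_restrictedTableau (w : ℕ → ℕ) (j i : ℕ) :
    (restrictedTableau w j i).EntriesLT j := by
  induction i with
  | zero => simp [restrictedTableau, Tableau.EntriesLT]
  | succ i ih =>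
    by_cases h : w i < j
    · simpa [restrictedTableau, h] using ih.tabInsert h
    · simpa [restrictedTableau, h] using ih

theorem vertLabel_eq_none {w : ℕ → ℕ} {j i : ℕ} (h : ∀ i' < i, w i' ≠ j) :
    vertLabel w j i = none := by
  induction i with
  | zero => rfl
  | succ i ih => simp [vertLabel, h i (by omega), ih fun i' hi' => h i' (by omega)]

/-- Passing from the letters less than `j` to those less than `j + 1` puts `j` at the end of the row
given by the vertical label. -/
theorem restrictedTableau_succ {w : ℕ → ℕ} (hw : Function.Injective w) (j i : ℕ) :
    (vertLabel w j i = none ∧ restrictedTableau w (j + 1) i = restrictedTableau w j i) ∨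
      ∃ s ≤ (restrictedTableau w j i).length, vertLabel w j i = some s ∧
        restrictedTableau w (j + 1) i = appendAt j s (restrictedTableau w j i) := by
  induction i with
  | zero => exact Or.inl ⟨rfl, rfl⟩
  | succ i ih =>
    have hT := entriesLT_restrictedTableau w j i
    rcases lt_trichotomy (w i) j with hlt | heq | hgt
    · have h1 : w i < j + 1 := by omega
      rcases ih with ⟨hv, he⟩ | ⟨s, hs, hv, he⟩
      · left
        simp [vertLabel, restrictedTableau, horLabel, hlt, hlt.ne, h1, hv, he]
      · right
        have hl := length_tabInsert (w i) (restrictedTableau w j i)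
        refine ⟨if insertRow (w i) (restrictedTableau w j i) = s then s + 1 else s, ?_, ?_, ?_⟩
        · simp only [restrictedTableau, if_pos hlt]
          split_ifs <;> omega
        · simp only [vertLabel, horLabel, hlt, hlt.ne, hv, if_true, if_false, Option.some.injEq]
          split_ifs <;> simp
        · simp only [restrictedTableau, if_pos hlt, if_pos h1, he]
          exact (tabInsert_appendAt hT hlt hs).1
    · right
      have hnone : vertLabel w j i = none :=
        vertLabel_eq_none fun i' hi' h => hi'.ne (hw (h.trans heq.symm))
      have he : restrictedTableau w (j + 1) i = restrictedTableau w j i := by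
        rcases ih with h | ⟨s, _, hv, _⟩
        · exact h.2
        · simp [hnone] at hv
      refine ⟨0, Nat.zero_le _, by simp [vertLabel, heq], ?_⟩
      simp only [restrictedTableau, heq, lt_irrefl, if_false, Nat.lt_succ_self, if_true, he]
      exact (tabInsert_of_entriesLT hT).1
    · have h1 : ¬ w i < j + 1 := by omega
      have h2 : ¬ w i < j := by omega
      rcases ih with ⟨hv, he⟩ | ⟨s, hs, hv, he⟩
      · left
        simp [vertLabel, restrictedTableau, horLabel, h2, hgt.ne', h1, hv, he]
      · right
        exact ⟨s, by simpa [restrictedTableau, h2] using hs,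
          by simp [vertLabel, horLabel, h2, hgt.ne', hv],
          by simp [restrictedTableau, h1, h2, he]⟩

/-- The shapes of the restricted insertion tableaux of `w` form the growth diagram of its graph. -/
theorem isGrowth_of_injective {w : ℕ → ℕ} (hw : Function.Injective w) (n : ℕ) :
    IsGrowth n (fun i j => w i = j) (horLabel w) (fun i j => vertLabel w j i) := by
  refine ⟨fun i _ => by simp [horLabel], fun j _ => rfl, fun i _ j _ => ?_⟩
  have hT := entriesLT_restrictedTableau w j i
  have hrec := restrictedTableau_succ hw j i
  rcases lt_trichotomy (w i) j with hlt | heq | hgt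
  · have h1 : w i < j + 1 := by omega
    have hl : horLabel w i j = some (insertRow (w i) (restrictedTableau w j i)) := if_pos hlt
    have hv : vertLabel w j (i + 1) =
        if horLabel w i j = vertLabel w j i then (vertLabel w j i).map (· + 1)
        else vertLabel w j i := by
      simp [vertLabel, hlt.ne]
    have ht : horLabel w i (j + 1) =
        if horLabel w i j = vertLabel w j i then (vertLabel w j i).map (· + 1)
        else horLabel w i j := by
      rcases hrec with ⟨hv, he⟩ | ⟨s, hs, hv, he⟩
      · rw [hv, hl]
        simp [horLabel, h1, he]
      · rw [hv, hl]
        simp only [horLabel, h1, if_true, he, (tabInsert_appendAt hT hlt hs).2, Option.some.injEq,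
          Option.map_some]
        split_ifs <;> rfl
    rw [ht, hv]
    by_cases hab : horLabel w i j = vertLabel w j i
    · simp only [hab, if_true]
      exact .bump hlt.ne _
    · simp only [hab, if_false]
      exact .cross hlt.ne hab
  · have hnone : vertLabel w j i = none :=
      vertLabel_eq_none fun i' hi' h => hi'.ne (hw (h.trans heq.symm))
    have he : restrictedTableau w (j + 1) i = restrictedTableau w j i := by
      rcases hrec with h | ⟨s, _, hv, _⟩
      · exact h.2
      · simp [hnone] at hv
    have ht : horLabel w i (j + 1) = some 0 := by
      simp [horLabel, heq, he, (tabInsert_of_entriesLT hT).2]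
    have ha : horLabel w i j = none := by simp [horLabel, heq]
    have hv : vertLabel w j (i + 1) = some 0 := by simp [vertLabel, heq]
    rw [ht, ha, hv, hnone]
    exact .point heq
  · have ha : horLabel w i j = none := if_neg (by omega)
    have ht : horLabel w i (j + 1) = none := if_neg (by omega)
    have hv : vertLabel w j (i + 1) = vertLabel w j i := by
      simp only [vertLabel, hgt.ne', ha, if_false]
      split_ifs with h
      · simp [← h]
      · rfl
    rw [ht, ha, hv]
    by_cases h : vertLabel w j i = none
    · rw [h]
      exact .bump hgt.ne' none
    · exact .cross hgt.ne' (Ne.symm h)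

theorem rowLen_restrictedTableau (w : ℕ → ℕ) (i j r : ℕ) :
    ((restrictedTableau w j i).rowLen r : ℤ) = partAt (horLabel w) i j r := by
  induction i with
  | zero => simp [restrictedTableau, partAt]
  | succ i ih =>
    rw [partAt_succ_left, ← ih]
    by_cases h : w i < j
    · simp [restrictedTableau, h, rowLen_tabInsert, horLabel, cellCount]
    · simp [restrictedTableau, h, horLabel, cellCount]

theorem sh_pos_tabInsert (x : ℕ) {T : Tableau} (hT : ∀ m ∈ T.sh, 0 < m) :
    ∀ m ∈ (tabInsert x T).sh, 0 < m := by
  induction T generalizing x with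
  | nil => simp [tabInsert, Tableau.sh]
  | cons q T ih =>
    simp only [Tableau.sh, List.map_cons, List.forall_mem_cons] at hT
    have hq : 0 < (rowInsert x q).1.length := by rw [length_rowInsert]; omega
    rcases h : (rowInsert x q).2 with _ | y
    · simp only [tabInsert, h, Tableau.sh, List.map_cons, List.forall_mem_cons]
      exact ⟨hq, hT.2⟩
    · simp only [tabInsert, h, Tableau.sh, List.map_cons, List.forall_mem_cons]
      exact ⟨hq, ih y hT.2⟩

theorem sh_pos_restrictedTableau (w : ℕ → ℕ) (j i : ℕ) :
    ∀ m ∈ (restrictedTableau w j i).sh, 0 < m := by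
  induction i with
  | zero => simp [restrictedTableau, Tableau.sh]
  | succ i ih =>
    by_cases h : w i < j
    · simpa only [restrictedTableau, h, if_true] using sh_pos_tabInsert (w i) ih
    · simpa only [restrictedTableau, h, if_false] using ih

theorem eq_of_getD_eq : ∀ {l m : List ℕ}, (∀ x ∈ l, 0 < x) → (∀ x ∈ m, 0 < x) →
    (∀ r, l.getD r 0 = m.getD r 0) → l = m
  | [], [], _, _, _ => rfl
  | [], y :: m, _, hm, h => by have := h 0; have := hm y (by simp); simp_all
  | x :: l, [], hl, _, h => by have := h 0; have := hl x (by simp); simp_all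
  | x :: l, y :: m, hl, hm, h => by
    have h₀ : x = y := by simpa using h 0
    have := eq_of_getD_eq (l := l) (m := m) (fun z hz => hl z (by simp [hz]))
      (fun z hz => hm z (by simp [hz])) (fun r => by simpa using h (r + 1))
    rw [h₀, this]

/-! ### The growth diagram of a permutation -/

/-- The one-line notation of a permutation of `Fin n`, continued by the identity to an injective
map on `ℕ`. -/
def word {n : ℕ} (π : Equiv.Perm (Fin n)) (i : ℕ) : ℕ := if h : i < n then π ⟨i, h⟩ else i

variable {π σ : Equiv.Perm (Fin n)}

theorem word_of_lt (π : Equiv.Perm (Fin n)) {i : ℕ} (h : i < n) : word π i = π ⟨i, h⟩ := dif_pos h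

theorem word_lt (π : Equiv.Perm (Fin n)) {i : ℕ} (h : i < n) : word π i < n := by
  rw [word_of_lt π h]
  exact Fin.isLt _

theorem word_injective (π : Equiv.Perm (Fin n)) : Function.Injective (word π) := by
  intro i j hij
  by_cases hi : i < n <;> by_cases hj : j < n <;> simp only [word, hi, hj, dif_pos, dif_neg,
    not_false_eq_true] at hij
  · simpa using π.injective (Fin.ext hij)
  · have := (π ⟨i, hi⟩).isLt; omega
  · have := (π ⟨j, hj⟩).isLt; omega
  · exact hij

/-- The labels on the top side of the growth diagram of `π`: the rows of the cells that the
letters of `π` add to the insertion tableau. They encode the recording tableau. -/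
def topLabel (π : Equiv.Perm (Fin n)) (i : ℕ) : Option ℕ := horLabel (word π) i n

/-- The labels on the right side of the growth diagram of `π`: the rows of the letters in the
insertion tableau. -/
def rightLabel (π : Equiv.Perm (Fin n)) (j : ℕ) : Option ℕ := vertLabel (word π) j n

theorem isGrowth_perm (π : Equiv.Perm (Fin n)) : IsGrowth n (fun i j => word π i = j)
    (horLabel (word π)) (fun i j => vertLabel (word π) j i) :=
  isGrowth_of_injective (word_injective π) n

theorem fst_foldl_rsStep (w : ℕ → ℕ) (l : List ℕ) (PQ : Tableau × Tableau) :
    (l.foldl (fun PQ i => rsStep PQ i (w i)) PQ).1 =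
      l.foldl (fun T i => tabInsert (w i) T) PQ.1 := by
  induction l generalizing PQ with
  | nil => rfl
  | cons i l ih => simp only [List.foldl_cons, ih]; rfl

theorem RS_fst (π : Equiv.Perm (Fin n)) : (RS π).1 = restrictedTableau (word π) n n := by
  have h₁ : RS π = (List.range n).foldl (fun PQ i => rsStep PQ i (word π i)) ([], []) := by
    rw [← List.map_coe_finRange_eq_range, List.foldl_map, RS]
    simp [word_of_lt]
  have h₂ : ∀ m ≤ n, (List.range m).foldl (fun T i => tabInsert (word π i) T) [] =
      restrictedTableau (word π) n m := by
    intro m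
    induction m with
    | zero => intro _; rfl
    | succ m ih =>
      intro hm
      rw [List.range_succ, List.foldl_append, ih (by omega)]
      simp [restrictedTableau, word_lt π hm]
  rw [h₁, fst_foldl_rsStep, h₂ n le_rfl]

/-- The partition at the upper right corner of the growth diagram is the shape. -/
theorem getD_sh (π : Equiv.Perm (Fin n)) (r : ℕ) :
    ((sh π).getD r 0 : ℤ) = partAt (horLabel (word π)) n n r := by
  rw [← rowLen_restrictedTableau, sh, RS_fst]
  rfl

theorem sh_eq_iff : sh π = sh σ ↔
    ∀ r, partAt (horLabel (word π)) n n r = partAt (horLabel (word σ)) n n r := by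
  constructor
  · intro h r
    rw [← getD_sh, ← getD_sh, h]
  · intro h
    refine eq_of_getD_eq ?_ ?_ fun r => by
      have := h r
      rw [← getD_sh, ← getD_sh] at this
      exact_mod_cast this
    · rw [sh, RS_fst]; exact sh_pos_restrictedTableau _ _ _
    · rw [sh, RS_fst]; exact sh_pos_restrictedTableau _ _ _

theorem sh_eq_of_topLabel_eq (h : ∀ i < n, topLabel π i = topLabel σ i) : sh π = sh σ :=
  sh_eq_iff.2 fun r => Finset.sum_congr rfl fun i hi => by
    rw [show horLabel (word π) i n = horLabel (word σ) i n from h i (Finset.mem_range.1 hi)]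

/-- A permutation is determined by the labels on the top and right sides of its growth diagram. -/
theorem perm_eq_of_labels (htop : ∀ i < n, topLabel π i = topLabel σ i)
    (hright : ∀ j < n, rightLabel π j = rightLabel σ j) : π = σ := by
  ext i
  have := (isGrowth_perm π).points_unique (isGrowth_perm σ) htop hright i i.2 _ (π i).2
  rw [word_of_lt π i.2, word_of_lt σ i.2] at this
  exact (this.1 rfl).symm

/-- A growth diagram whose top labels all differ from `none` has a point in every column, and at
most one in every row and column, so it belongs to a permutation. -/
theorem exists_perm_of_growth {p : ℕ → ℕ → Prop} {A B : ℕ → ℕ → Option ℕ} (h : IsGrowth n p A B)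
    (htop : ∀ i < n, A i n ≠ none) :
    ∃ τ : Equiv.Perm (Fin n), (∀ i < n, topLabel τ i = A i n) ∧
      ∀ j < n, rightLabel τ j = B n j := by
  choose f hf hp using fun i : Fin n => h.exists_point i.2 (htop i i.2)
  let g : Fin n → Fin n := fun i => ⟨f i, hf i⟩
  have hg : Function.Injective g := by
    intro i i' hii
    have e : f i = f i' := congrArg Fin.val hii
    exact Fin.ext (h.flip.point_unique (hf i) i.2 i'.2 (hp i) (by rw [e]; exact hp i'))
  let τ : Equiv.Perm (Fin n) := Equiv.ofBijective g (Finite.injective_iff_bijective.1 hg)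
  have hτ : ∀ i < n, ∀ j < n, (p i j ↔ word τ i = j) := by
    intro i hi j hj
    have e : word τ i = f ⟨i, hi⟩ := word_of_lt τ hi
    rw [e]
    exact ⟨fun hij => h.point_unique hi (hf _) hj (hp ⟨i, hi⟩) hij, fun e => e ▸ hp ⟨i, hi⟩⟩
  have h' : IsGrowth n (fun i j => word τ i = j) A B :=
    ⟨h.bottom, h.left, fun i hi j hj => propext (hτ i hi j hj) ▸ h.cell i hi j hj⟩
  have u := fun i hi => (isGrowth_perm τ).labels_unique h' (i := i) hi
  exact ⟨τ, fun i hi => (u i hi.le).2 hi n le_rfl, (u n le_rfl).1⟩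

/-- Any recording tableau and any insertion tableau of the same shape belong to a permutation. -/
theorem exists_perm_of_sh_eq (h : sh π = sh σ) : ∃ τ : Equiv.Perm (Fin n),
    (∀ i < n, topLabel τ i = topLabel π i) ∧ ∀ j < n, rightLabel τ j = rightLabel σ j := by
  obtain ⟨p, A, B, hg, htop, hright⟩ :=
    exists_growth_of_partAt_eq (isGrowth_perm π) (isGrowth_perm σ) (sh_eq_iff.1 h)
  obtain ⟨τ, h₁, h₂⟩ := exists_perm_of_growth hg fun i hi => by
    rw [htop i hi]
    simp [horLabel, word_lt π hi]
  exact ⟨τ, fun i hi => (h₁ i hi).trans (htop i hi), fun j hj => (h₂ j hj).trans (hright j hj)⟩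

/-- The growth diagram of `π⁻¹` is the reflection of that of `π`. -/
theorem labels_inv (π : Equiv.Perm (Fin n)) :
    (∀ i < n, topLabel π⁻¹ i = rightLabel π i) ∧ ∀ j < n, rightLabel π⁻¹ j = topLabel π j := by
  have hf := (isGrowth_perm π).flip
  have hp : ∀ i < n, ∀ j < n, (word π j = i ↔ word π⁻¹ i = j) := by
    intro i hi j hj
    rw [word_of_lt π hj, word_of_lt π⁻¹ hi]
    have : π ⟨j, hj⟩ = ⟨i, hi⟩ ↔ π⁻¹ ⟨i, hi⟩ = ⟨j, hj⟩ := by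
      rw [Equiv.Perm.inv_eq_iff_eq, eq_comm]
    simpa [Fin.ext_iff] using this
  have h' : IsGrowth n (fun i j => word π⁻¹ i = j) _ _ :=
    ⟨hf.bottom, hf.left, fun i hi j hj => propext (hp i hi j hj) ▸ hf.cell i hi j hj⟩
  have u := fun i hi => (isGrowth_perm π⁻¹).labels_unique h' (i := i) hi
  exact ⟨fun i hi => (u i hi.le).2 hi n le_rfl, (u n le_rfl).1⟩

theorem sh_inv (π : Equiv.Perm (Fin n)) : sh π⁻¹ = sh π := by
  refine sh_eq_iff.2 fun r => ?_
  rw [(isGrowth_perm π).partAt_eq_sum_right le_rfl]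
  exact Finset.sum_congr rfl fun i hi => by
    rw [show horLabel (word π⁻¹) i n = vertLabel (word π) i n from
      (labels_inv π).1 i (Finset.mem_range.1 hi)]

/-! ### Longest increasing subsequences -/

/-- The set `s` of positions carries an increasing subsequence of `π`. -/
def IncreasingOn (π : Equiv.Perm (Fin n)) (s : Finset (Fin n)) : Prop :=
  ∀ a ∈ s, ∀ b ∈ s, a < b → π a < π b

/-- All positions in `s` are less than `i`, and all letters of `π` in these positions are less
than `j`. -/
def InRect (π : Equiv.Perm (Fin n)) (i j : ℕ) (s : Finset (Fin n)) : Prop :=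
  ∀ a ∈ s, (a : ℕ) < i ∧ (π a : ℕ) < j

/-- The first row of the partition at `(i, j)` has the length of a longest increasing subsequence
among the points of `π` below and to the left of `(i, j)`, since both satisfy the same recursion:
they grow by one at a point, and are the maximum of their values at the upper left and lower
right corners of a cell without a point. -/
theorem partAt_zero_eq_longest (π : Equiv.Perm (Fin n)) {i j : ℕ} (hi : i ≤ n) (hj : j ≤ n) :
    (∀ s, IncreasingOn π s → InRect π i j s → (s.card : ℤ) ≤ partAt (horLabel (word π)) i j 0) ∧
      ∃ s, IncreasingOn π s ∧ InRect π i j s ∧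
        (s.card : ℤ) = partAt (horLabel (word π)) i j 0 := by
  have hg := isGrowth_perm π
  induction i generalizing j with
  | zero =>
    refine ⟨fun s _ hs => ?_, ∅, by simp [IncreasingOn], by simp [InRect], by simp [partAt]⟩
    have : s = ∅ := Finset.eq_empty_of_forall_notMem fun a ha => by have := (hs a ha).1; omega
    simp [this, partAt]
  | succ i ih =>
    induction j with
    | zero =>
      refine ⟨fun s _ hs => ?_, ∅, by simp [IncreasingOn], by simp [InRect],
        by simp [hg.partAt_zero_right hi]⟩
      have : s = ∅ := Finset.eq_empty_of_forall_notMem fun a ha => by have := (hs a ha).2; omega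
      simp [this, hg.partAt_zero_right hi]
    | succ j ihj =>
      have hc := hg.cell i hi j hj
      have e₁ := hg.partAt_succ_right hi hj 0
      have e₂ := partAt_succ_left (horLabel (word π)) i (j + 1) 0
      have e₃ := partAt_succ_left (horLabel (word π)) i j 0
      obtain ⟨up, s₁, inc₁, rect₁, card₁⟩ := ih (j := j + 1) (by omega) hj
      obtain ⟨right, s₂, inc₂, rect₂, card₂⟩ := ihj (by omega)
      obtain ⟨diag, s₀, inc₀, rect₀, card₀⟩ := ih (j := j) (by omega) (by omega)
      have hw : word π i = π ⟨i, hi⟩ := word_of_lt π hi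
      by_cases hp : word π i = j
      · have hval : partAt (horLabel (word π)) (i + 1) (j + 1) 0 =
            partAt (horLabel (word π)) i j 0 + 1 := by
          rw [e₁, e₃, hc.bottom_eq_none hp, hc.right_eq_some_zero hp]
          simp [cellCount]
        rw [hval]
        constructor
        · intro s hs hr
          have : (s.card : ℤ) ≤ (s.erase ⟨i, hi⟩).card + 1 := by
            have := Finset.pred_card_le_card_erase (s := s) (a := ⟨i, hi⟩)
            omega
          refine this.trans (by
            have := diag (s.erase ⟨i, hi⟩)
              (fun a ha b hb => hs a (Finset.mem_of_mem_erase ha) b (Finset.mem_of_mem_erase hb)) ?_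
            · linarith
            intro a ha
            have ha' := hr a (Finset.mem_of_mem_erase ha)
            have hne := Finset.ne_of_mem_erase ha
            have h₁ : (a : ℕ) ≠ i := fun h => hne (Fin.ext h)
            have h₂ : (π a : ℕ) ≠ j := fun h =>
              hne (π.injective (Fin.ext (by rw [h, ← hw, hp])))
            omega)
        · have hnot : (⟨i, hi⟩ : Fin n) ∉ s₀ := fun h => lt_irrefl _ (rect₀ _ h).1
          refine ⟨insert ⟨i, hi⟩ s₀, ?_, ?_, ?_⟩
          · intro a ha b hb hab
            rcases Finset.mem_insert.1 ha with rfl | ha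
            · rcases Finset.mem_insert.1 hb with rfl | hb
              · exact absurd hab (lt_irrefl _)
              · have := (rect₀ b hb).1
                rw [Fin.lt_def] at hab
                simp only at hab
                omega
            · rcases Finset.mem_insert.1 hb with rfl | hb
              · have := (rect₀ a ha).2
                rw [Fin.lt_def]
                omega
              · exact inc₀ a ha b hb hab
          · intro a ha
            rcases Finset.mem_insert.1 ha with rfl | ha
            · simp only
              omega
            · have := rect₀ a ha
              omega
          · rw [Finset.card_insert_of_notMem hnot]
            push_cast
            rw [card₀]
      · have m₁ := cellCount_nonneg (horLabel (word π) i (j + 1)) 0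
        have m₂ := cellCount_nonneg (vertLabel (word π) j (i + 1)) 0
        constructor
        · intro s hs hr
          by_cases his : (⟨i, hi⟩ : Fin n) ∈ s
          · have := right s hs fun a ha => by
              refine ⟨(hr a ha).1, lt_of_le_of_ne (Nat.le_of_lt_succ (hr a ha).2) fun haj => ?_⟩
              -- The letter `j`, left of position `i`, would form an inversion with `π i < j`.
              have hne : (a : ℕ) ≠ i := by
                rintro rfl
                exact hp (hw.trans haj)
              have hlt : a < (⟨i, hi⟩ : Fin n) := by
                have := (hr a ha).1
                rw [Fin.lt_def]
                simp only
                omega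
              have h₁ := hs a ha _ his hlt
              have h₂ := (hr _ his).2
              rw [Fin.lt_def] at h₁
              omega
            linarith
          · have := up s hs fun a ha => by
              refine ⟨lt_of_le_of_ne (Nat.le_of_lt_succ (hr a ha).1) fun h => his ?_, (hr a ha).2⟩
              rwa [show (⟨i, hi⟩ : Fin n) = a from Fin.ext h.symm]
            linarith
        · rcases hc.cellCount_zero_eq_zero hp with h | h
          · exact ⟨s₁, inc₁, fun a ha => ⟨(rect₁ a ha).1.trans i.lt_succ_self, (rect₁ a ha).2⟩,
              by rw [card₁, e₂, h, add_zero]⟩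
          · exact ⟨s₂, inc₂, fun a ha => ⟨(rect₂ a ha).1, (rect₂ a ha).2.trans j.lt_succ_self⟩,
              by rw [card₂, e₁, h, add_zero]⟩

/-- Schensted's theorem: the first row of the shape of `π` has length `lis π`. -/
theorem lis_eq_getD_sh (π : Equiv.Perm (Fin n)) : lis π = (sh π).getD 0 0 := by
  obtain ⟨hle, s, hs, -, hcard⟩ := partAt_zero_eq_longest π le_rfl le_rfl
  rw [← getD_sh] at hle hcard
  refine le_antisymm (Finset.sup_le fun t ht => ?_) ?_
  · exact_mod_cast hle t (Finset.mem_filter.1 ht).2 fun a _ => ⟨a.2, (π a).2⟩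
  · rw [← Int.natCast_inj.1 hcard]
    exact Finset.le_sup (f := Finset.card) (Finset.mem_filter.2 ⟨Finset.mem_univ _, hs⟩)

theorem lis_eq_of_sh_eq (h : sh π = sh σ) : lis π = lis σ := by
  rw [lis_eq_getD_sh, lis_eq_getD_sh, h]

/-! ### Permutations as pairs of involutions -/

/-- The insertion and recording tableaux of an involution agree. -/
theorem rightLabel_of_sq_eq_one (h : π ^ 2 = 1) (j : ℕ) (hj : j < n) :
    rightLabel π j = topLabel π j := by
  have : π⁻¹ = π := by rw [inv_eq_iff_mul_eq_one, ← sq, h]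
  have h' := (labels_inv π).2 j hj
  rwa [this] at h'

/-- Every recording tableau is the recording tableau of an involution. -/
theorem exists_involution (π : Equiv.Perm (Fin n)) :
    ∃ τ : Equiv.Perm (Fin n), τ ^ 2 = 1 ∧ ∀ i < n, topLabel τ i = topLabel π i := by
  obtain ⟨τ, htop, hright⟩ := exists_perm_of_sh_eq (sh_inv π).symm
  refine ⟨τ, ?_, htop⟩
  have hlab : ∀ j < n, rightLabel τ j = topLabel τ j := fun j hj => by
    rw [hright j hj, htop j hj, (labels_inv π).2 j hj]
  have : τ⁻¹ = τ := perm_eq_of_labels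
    (fun i hi => by rw [(labels_inv τ).1 i hi, hlab i hi])
    (fun j hj => by rw [(labels_inv τ).2 j hj, hlab j hj])
  rwa [sq, ← inv_eq_iff_mul_eq_one]

/-- The involution whose insertion and recording tableau are both the recording tableau of `π`. -/
noncomputable def involutionOf (π : Equiv.Perm (Fin n)) : Equiv.Perm (Fin n) :=
  (exists_involution π).choose

theorem involutionOf_sq (π : Equiv.Perm (Fin n)) : involutionOf π ^ 2 = 1 :=
  (exists_involution π).choose_spec.1

theorem topLabel_involutionOf (π : Equiv.Perm (Fin n)) :
    ∀ i < n, topLabel (involutionOf π) i = topLabel π i :=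
  (exists_involution π).choose_spec.2

theorem sh_involutionOf (π : Equiv.Perm (Fin n)) : sh (involutionOf π) = sh π :=
  sh_eq_of_topLabel_eq (topLabel_involutionOf π)

theorem involutionOf_mem_I {k : ℕ} (h : π ∈ L n k) : involutionOf π ∈ I n k :=
  ⟨involutionOf_sq π, (lis_eq_of_sh_eq (sh_involutionOf π)).trans h⟩

theorem involutionOf_inv_mem_I {k : ℕ} (h : π ∈ L n k) : involutionOf π⁻¹ ∈ I n k :=
  ⟨involutionOf_sq _, (lis_eq_of_sh_eq ((sh_involutionOf _).trans (sh_inv π))).trans h⟩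

/-- A permutation is determined by the two involutions that share its recording tableau and its
insertion tableau. -/
theorem eq_of_involutionOf_eq (h : involutionOf π = involutionOf σ)
    (h' : involutionOf π⁻¹ = involutionOf σ⁻¹) : π = σ := by
  refine perm_eq_of_labels (fun i hi => ?_) fun j hj => ?_
  · rw [← topLabel_involutionOf π i hi, h, topLabel_involutionOf σ i hi]
  · rw [← (labels_inv π).1 j hj, ← (labels_inv σ).1 j hj, ← topLabel_involutionOf π⁻¹ j hj, h',
      topLabel_involutionOf σ⁻¹ j hj]

/-- For involutions `ρ` and `σ` of the same shape, the permutation with the recording tableau of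
`ρ` and the insertion tableau of `σ`; for other pairs, a junk value. -/
noncomputable def combine (ρ σ : Equiv.Perm (Fin n)) : Equiv.Perm (Fin n) :=
  open Classical in if h : sh ρ = sh σ then (exists_perm_of_sh_eq h).choose else 1

theorem topLabel_combine {ρ : Equiv.Perm (Fin n)} (h : sh ρ = sh σ) :
    ∀ i < n, topLabel (combine ρ σ) i = topLabel ρ i := by
  rw [combine, dif_pos h]
  exact (exists_perm_of_sh_eq h).choose_spec.1

theorem rightLabel_combine {ρ : Equiv.Perm (Fin n)} (h : sh ρ = sh σ) :
    ∀ j < n, rightLabel (combine ρ σ) j = rightLabel σ j := by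
  rw [combine, dif_pos h]
  exact (exists_perm_of_sh_eq h).choose_spec.2

theorem sh_combine {ρ : Equiv.Perm (Fin n)} (h : sh ρ = sh σ) : sh (combine ρ σ) = sh ρ :=
  sh_eq_of_topLabel_eq (topLabel_combine h)

theorem eq_of_topLabel_eq_of_sq_eq_one (hπ : π ^ 2 = 1) (hσ : σ ^ 2 = 1)
    (h : ∀ i < n, topLabel π i = topLabel σ i) : π = σ :=
  perm_eq_of_labels h fun j hj => by
    rw [rightLabel_of_sq_eq_one hπ j hj, rightLabel_of_sq_eq_one hσ j hj, h j hj]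

theorem combine_injective {ρ ρ' σ' : Equiv.Perm (Fin n)} (hρ : ρ ^ 2 = 1) (hσ : σ ^ 2 = 1)
    (hρ' : ρ' ^ 2 = 1) (hσ' : σ' ^ 2 = 1) (h : sh ρ = sh σ) (h' : sh ρ' = sh σ')
    (he : combine ρ σ = combine ρ' σ') : ρ = ρ' ∧ σ = σ' := by
  refine ⟨eq_of_topLabel_eq_of_sq_eq_one hρ hρ' fun i hi => ?_,
    eq_of_topLabel_eq_of_sq_eq_one hσ hσ' fun i hi => ?_⟩
  · rw [← topLabel_combine h i hi, he, topLabel_combine h' i hi]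
  · rw [← rightLabel_of_sq_eq_one hσ i hi, ← rightLabel_of_sq_eq_one hσ' i hi,
      ← rightLabel_combine h i hi, he, rightLabel_combine h' i hi]

/-! ### Lifting injections from involutions to permutations -/

/-- The lifting of an injection from pairs of involutions to pairs of permutations: it acts on the
pair of recording tableaux and on the pair of insertion tableaux separately. -/
theorem exists_injection_of_involutions {a b k : ℕ} (f : I n a × I n b → I n k × I n k)
    (hf : Function.Injective f)
    (hsh : ShapePreserving f) :
    ∃ F : L n a × L n b → L n k × L n k, Function.Injective F ∧ ShapePreserving F := by
  let recs : L n a × L n b → I n a × I n b := fun x =>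
    (⟨_, involutionOf_mem_I x.1.2⟩, ⟨_, involutionOf_mem_I x.2.2⟩)
  let ins : L n a × L n b → I n a × I n b := fun x =>
    (⟨_, involutionOf_inv_mem_I x.1.2⟩, ⟨_, involutionOf_inv_mem_I x.2.2⟩)
  have hri : ∀ x, sh (f (recs x)).1.1 = sh (f (ins x)).1.1 ∧
      sh (f (recs x)).2.1 = sh (f (ins x)).2.1 := fun x =>
    Prod.ext_iff.1 (hsh (recs x) (ins x) (Prod.ext
      (by simp only [recs, ins, pairSh, sh_involutionOf, sh_inv])
      (by simp only [recs, ins, pairSh, sh_involutionOf, sh_inv])))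
  let F : L n a × L n b → L n k × L n k := fun x =>
    (⟨combine (f (recs x)).1.1 (f (ins x)).1.1,
        (lis_eq_of_sh_eq (sh_combine (hri x).1)).trans (f (recs x)).1.2.2⟩,
      ⟨combine (f (recs x)).2.1 (f (ins x)).2.1,
        (lis_eq_of_sh_eq (sh_combine (hri x).2)).trans (f (recs x)).2.2.2⟩)
  refine ⟨F, fun x y hxy => ?_, fun x y hxy => ?_⟩
  · have h₁ : combine (f (recs x)).1.1 (f (ins x)).1.1 =
        combine (f (recs y)).1.1 (f (ins y)).1.1 := congrArg (fun z => z.1.1) hxy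
    have h₂ : combine (f (recs x)).2.1 (f (ins x)).2.1 =
        combine (f (recs y)).2.1 (f (ins y)).2.1 := congrArg (fun z => z.2.1) hxy
    obtain ⟨r₁, i₁⟩ := combine_injective (f (recs x)).1.2.1 (f (ins x)).1.2.1
      (f (recs y)).1.2.1 (f (ins y)).1.2.1 (hri x).1 (hri y).1 h₁
    obtain ⟨r₂, i₂⟩ := combine_injective (f (recs x)).2.2.1 (f (ins x)).2.2.1
      (f (recs y)).2.2.1 (f (ins y)).2.2.1 (hri x).2 (hri y).2 h₂
    have hr : recs x = recs y := hf (Prod.ext (Subtype.ext r₁) (Subtype.ext r₂))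
    have hi : ins x = ins y := hf (Prod.ext (Subtype.ext i₁) (Subtype.ext i₂))
    exact Prod.ext
      (Subtype.ext (eq_of_involutionOf_eq (congrArg (fun z => z.1.1) hr)
        (congrArg (fun z => z.1.1) hi)))
      (Subtype.ext (eq_of_involutionOf_eq (congrArg (fun z => z.2.1) hr)
        (congrArg (fun z => z.2.1) hi)))
  · have hF : ∀ x, pairSh ((F x).1.1, (F x).2.1) =
        pairSh ((f (recs x)).1.1, (f (recs x)).2.1) := fun x =>
      Prod.ext (sh_combine (hri x).1) (sh_combine (hri x).2)
    rw [hF, hF]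
    refine hsh _ _ ?_
    simpa only [recs, pairSh, sh_involutionOf] using hxy

theorem ncard_mul_ncard_le_of_injective {a b k : ℕ} {F : L n a × L n b → L n k × L n k}
    (hF : Function.Injective F) : (L n a).ncard * (L n b).ncard ≤ (L n k).ncard ^ 2 := by
  simpa only [Nat.card_prod, Nat.card_coe_set_eq, sq] using Nat.card_le_card_of_injective F hF

end IncSubseq

theorem theorem2p2 (n : ℕ) :
    (∀ k : ℕ, 1 ≤ k →
      (∃ f : IncSubseq.I n (k - 1) × IncSubseq.I n (k + 1) → IncSubseq.I n k × IncSubseq.I n k,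
        Function.Injective f ∧ IncSubseq.ShapePreserving f) →
      ∃ F : IncSubseq.L n (k - 1) × IncSubseq.L n (k + 1) → IncSubseq.L n k × IncSubseq.L n k,
        Function.Injective F ∧ IncSubseq.ShapePreserving F) ∧
    ((∀ k ∈ Finset.Icc 1 n,
      ∃ f : IncSubseq.I n (k - 1) × IncSubseq.I n (k + 1) → IncSubseq.I n k × IncSubseq.I n k,
        Function.Injective f ∧ IncSubseq.ShapePreserving f) →
      IncSubseq.LogConcave n (fun k => ((IncSubseq.L n k).ncard : ℝ))) := by
  constructor
  · rintro k - ⟨f, hf, hsh⟩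
    exact IncSubseq.exists_injection_of_involutions f hf hsh
  · intro h k hk
    obtain ⟨f, hf, hsh⟩ := h k hk
    obtain ⟨F, hF, -⟩ := IncSubseq.exists_injection_of_involutions f hf hsh
    have hle := IncSubseq.ncard_mul_ncard_le_of_injective hF
    split_ifs
    · simp
    · simp
    · simp
    · beta_reduce
      exact_mod_cast hle
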